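/- Let $N\ge 1$ and $d_1,\dots,d_N\ge 1$ be integers, let $\mathcal H=\bigotimes_{k=1}^N\mathbb C^{d_k}$ and $D=\dim\mathcal H=d_1d_2\cdots d_N$. States are unit vectors. Fix any numbering by $i=1,\dots,D/d_N$ of the standard product basis of $\bigotimes_{k=1}^{N-1}\mathbb C^{d_k}$, and let $$|\Phi\rangle=\sqrt{\frac{d_N}{D}}\sum_{i=1}^{D/d_N}|i\rangle\otimes|i\rangle\in\Big(\bigotimes_{k=1}^{N-1}\mathbb C^{d_k}\Big)\otimes\mathbb C^{D/d_N}=:\mathcal H',$$ where the second $|i\rangle$ is the $i$-th standard basis vector of $\mathbb C^{D/d_N}$. Thus each of the first $N-1$ parties shares a maximally entangled state with the $N$-th party. Write $d'_k=d_k$ for $k<N$ and $d'_N=D/d_N$, and regard $\mathcal H'\otimes\mathcal H$ as an $N$-partite system with local spaces $\mathbb C^{d'_k}\otimes\mathbb C^{d_k}$, $k=1,\dots,N$. An LOCC measurement is a POVM $\{\Pi_o\}$, $\sum_o\Pi_o=I$, implemented by a protocol with finitely many rounds. In each round one party performs a local measurement with finitely many outcomes and broadcasts the result, and the other parties may apply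 local isometries that depend on it. The local dimensions may change, later rounds may depend on all earlier results, and when the protocol stops, an outcome $o$ is announced. Then $|\Phi\rangle$ is a unit vector and it is a universal resource for both kinds of local discrimination in $\mathcal H$: 1. (Unambiguous discrimination.) For every finite linearly independent family of states $|\psi_1\rangle,\dots,|\psi_m\rangle\in\mathcal H$ there are an LOCC measurement $\{\Pi_1,\dots,\Pi_m,\Pi_{\mathrm{inconclusive}}\}$ on $\mathcal H'\otimes\mathcal H$ and constants $\epsilon_1,\dots,\epsilon_m>0$ such that $\langle\Phi\otimes\psi_j|\Pi_i|\Phi\otimes\psi_j\rangle=\delta_{ij}\epsilon_i$ for all $i,j\in\{1,\dots,m\}$. 2. (Perfect discrimination.) For every nonempty finite family of mutually orthogonal states $|\psi_1\rangle,\dots,|\psi_m\rangle\in\mathcal H$ there is an LOCC measurement $\{\Pi_1,\dots,\Pi_m\}$ on $\mathcal H'\otimes\mathcal H$ such that $\langle\Phi\otimes\psi_j|\Pi_i|\Phi\otimes\psi_j\rangle=\delta_{ij}$ for all $i,j\in\{1,\dots,m\}$. -/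

import Mathlib

open scoped Matrix

/-- Computational basis labels of the `N`-partite system `⨂ₖ ℂ^(d k)`. -/
abbrev PIdx {N : ℕ} (d : Fin N → ℕ) : Type := (k : Fin N) → Fin (d k)

/-- The Hilbert space `⨂ₖ ℂ^(d k)`, in coordinates with respect to the product basis. -/
abbrev PSpace {N : ℕ} (d : Fin N → ℕ) : Type := EuclideanSpace ℂ (PIdx d)

/-- The matrix of the product operator `⨂ₖ (B k)`. -/
def productOp {N : ℕ} {d d' : Fin N → ℕ}
    (B : (k : Fin N) → Matrix (Fin (d' k)) (Fin (d k)) ℂ) :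
    Matrix (PIdx d') (PIdx d) ℂ :=
  Matrix.of fun x y => ∏ k, B k (x k) (y k)

/-- `IsLOCC d M` says that the operators `M o` (`o` ranging over the final outcomes) are the
measurement operators (effects) of a finite-round LOCC protocol on `⨂ₖ ℂ^(d k)`.

A protocol either stops and announces an outcome, or it runs one more round. In a round one party
`k` performs a local measurement with Kraus operators `B m k`, `m < r`, and broadcasts the result
`m` to all the others, each of whom may apply a local isometry `B m j` that depends on `m` (for
instance attach an ancilla and apply a unitary); then the protocol continues on the new local spaces
`ℂ^(d' m j)` in a way which may depend on `m`. The effects of the whole protocol are the sums over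
`m` of the effects of the continuations, pulled back along the product operators `⨂ⱼ B m j`. -/
inductive IsLOCC {N : ℕ} {O : Type} [DecidableEq O] :
    (d : Fin N → ℕ) → (O → Matrix (PIdx d) (PIdx d) ℂ) → Prop
  | halt (d : Fin N → ℕ) (o₀ : O) :
      IsLOCC d (fun o => if o = o₀ then 1 else 0)
  | round (d : Fin N → ℕ) (k : Fin N) (r : ℕ) (d' : Fin r → Fin N → ℕ)
      (B : (m : Fin r) → (j : Fin N) → Matrix (Fin (d' m j)) (Fin (d j)) ℂ)
      (complete : ∑ m, (B m k)ᴴ * B m k = 1)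
      (isometry : ∀ m j, j ≠ k → (B m j)ᴴ * B m j = 1)
      (M : (m : Fin r) → O → Matrix (PIdx (d' m)) (PIdx (d' m)) ℂ)
      (next : ∀ m, IsLOCC (d' m) (M m)) :
      IsLOCC d (fun o => ∑ m, (productOp (B m))ᴴ * M m o * productOp (B m))

/-- The expectation value `⟨v| M |v⟩`; for an effect `M` and a state `v`, the probability of the
outcome. -/
def expect {N : ℕ} {d : Fin N → ℕ} (M : Matrix (PIdx d) (PIdx d) ℂ) (v : PSpace d) : ℂ :=
  star (v.ofLp) ⬝ᵥ (M *ᵥ v.ofLp)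

/-- The states `v i` can be perfectly distinguished with LOCC: some LOCC measurement with outcomes
`i` identifies the state with certainty. -/
def PerfectlyDistinguishable {N m : ℕ} {d : Fin N → ℕ} (v : Fin m → PSpace d) : Prop :=
  ∃ M : Fin m → Matrix (PIdx d) (PIdx d) ℂ,
    IsLOCC d M ∧ ∑ o, M o = 1 ∧
    ∀ i j, expect (M i) (v j) = if i = j then 1 else 0

/-- The states `v i` can be unambiguously distinguished with LOCC. The outcome `none` is the
inconclusive one. -/
def UnambiguouslyDistinguishable {N m : ℕ} {d : Fin N → ℕ} (v : Fin m → PSpace d) : Prop :=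
  ∃ M : Option (Fin m) → Matrix (PIdx d) (PIdx d) ℂ,
    IsLOCC d M ∧ ∑ o, M o = 1 ∧
    ∃ ε : Fin m → ℝ, (∀ i, 0 < ε i) ∧
      ∀ i j, expect (M (some i)) (v j) = if i = j then (ε i : ℂ) else 0

/-- `Φ ⊗ ψ` in `H' ⊗ H`, seen as an `N`-partite system whose `k`-th local space is
`ℂ^(d' k) ⊗ ℂ^(d k) = ℂ^(d' k * d k)`; the label `a * d k + b` stands for `|a⟩ ⊗ |b⟩`. -/
noncomputable def tensorState {N : ℕ} {d' d : Fin N → ℕ} (Φ : PSpace d') (ψ : PSpace d) :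
    PSpace (fun k => d' k * d k) :=
  WithLp.toLp 2 fun x => Φ (fun k => (x k).divNat) * ψ (fun k => (x k).modNat)

/-- `Φ` is universal for local (perfect) state discrimination in `⨂ₖ ℂ^(d k)`: it is a state, and
it makes every nonempty set of mutually orthogonal states perfectly distinguishable with LOCC. -/
def UniversalPerfect {N : ℕ} {d' : Fin N → ℕ} (d : Fin N → ℕ) (Φ : PSpace d') : Prop :=
  ‖Φ‖ = 1 ∧ ∀ (m : ℕ) (ψ : Fin m → PSpace d), 0 < m → Orthonormal ℂ ψ →
    PerfectlyDistinguishable (fun i => tensorState Φ (ψ i))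

/-- `Φ` is universal for local unambiguous discrimination in `⨂ₖ ℂ^(d k)`: it is a state, and it
makes every set of linearly independent states unambiguously distinguishable with LOCC. -/
def UniversalUnambiguous {N : ℕ} {d' : Fin N → ℕ} (d : Fin N → ℕ) (Φ : PSpace d') : Prop :=
  ‖Φ‖ = 1 ∧ ∀ (m : ℕ) (ψ : Fin m → PSpace d), (∀ i, ‖ψ i‖ = 1) → LinearIndependent ℂ ψ →
    UnambiguouslyDistinguishable (fun i => tensorState Φ (ψ i))

/-- Local dimensions of the resource system: `d k` for all parties but the last one, and for the
last one the product of the dimensions of all the other parties. -/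
def bellDim {n : ℕ} (d : Fin (n + 1) → ℕ) : Fin (n + 1) → ℕ :=
  Fin.lastCases (∏ k : Fin n, d k.castSucc) (fun k : Fin n => d k.castSucc)

theorem bellDim_last {n : ℕ} (d : Fin (n + 1) → ℕ) :
    bellDim d (Fin.last n) = ∏ k : Fin n, d k.castSucc := by
  simp [bellDim]

theorem bellDim_castSucc {n : ℕ} (d : Fin (n + 1) → ℕ) (k : Fin n) :
    bellDim d k.castSucc = d k.castSucc := by
  simp [bellDim]

/-- The state `√(d_N / D) ∑ᵢ |i ⊗ i⟩` in which each of the first `N - 1` parties shares a maximally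
entangled state with the last one (`N = n + 1`, `D = ∏ₖ d k`). The first factor `|i⟩` runs over the
product basis of the first `N - 1` parties, numbered by `e`; the second over the basis of the space
`ℂ^(D / d_N)` of the last party. -/
noncomputable def bellState {n : ℕ} (d : Fin (n + 1) → ℕ)
    (e : ((k : Fin n) → Fin (d k.castSucc)) ≃ Fin (∏ k : Fin n, d k.castSucc)) :
    PSpace (bellDim d) :=
  WithLp.toLp 2 fun x =>
    if e (fun k => Fin.cast (bellDim_castSucc d k) (x k.castSucc)) =
        Fin.cast (bellDim_last d) (x (Fin.last n))
    then ((Real.sqrt ((d (Fin.last n) : ℝ) / ((∏ k, d k : ℕ) : ℝ)) : ℝ) : ℂ)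
    else 0

/-! The proof is teleportation. Each party `k` other than the last measures its half of the resource
together with its own system in a Bell basis labelled by a character and a shift. Whatever the
results, the last party then holds an unnormalised copy of `ψ`, altered only by known phases and a
known relabelling of the basis, both of which are unitary. It undoes them and measures the whole
state alone.

The scale factor of that copy is the same for all results. Its square is the inverse of the number
of Bell results, so summing over them reproduces the statistics of the global measurement exactly
(`teleportOp_mulVec`, `expect_teleportOp`, `exists_isLOCC_expect_eq`).

It remains to find global POVMs. Orthonormal states are separated by their rank-one projectors, and
the complement is added to one outcome. Linearly independent states are separated by rank-one
operators on a dual family, scaled down until their sum is at most the identity. -/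

/-! ### Algebra of product operators. -/

section ProductOperators

variable {N : ℕ} {d d' d'' : Fin N → ℕ}

theorem productOp_apply (B : (k : Fin N) → Matrix (Fin (d' k)) (Fin (d k)) ℂ)
    (x : PIdx d') (y : PIdx d) : productOp B x y = ∏ k, B k (x k) (y k) := rfl

theorem productOp_mul (B : (k : Fin N) → Matrix (Fin (d'' k)) (Fin (d' k)) ℂ)
    (A : (k : Fin N) → Matrix (Fin (d' k)) (Fin (d k)) ℂ) :
    productOp B * productOp A = productOp (fun k => B k * A k) := by
  ext x y
  simp only [Matrix.mul_apply, productOp_apply, ← Finset.prod_mul_distrib]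
  rw [Finset.prod_univ_sum, Fintype.piFinset_univ]

theorem productOp_conjTranspose (B : (k : Fin N) → Matrix (Fin (d' k)) (Fin (d k)) ℂ) :
    (productOp B)ᴴ = productOp (fun k => (B k)ᴴ) := by
  ext x y
  simp [productOp_apply, Matrix.conjTranspose_apply]

theorem productOp_one :
    productOp (fun k => (1 : Matrix (Fin (d k)) (Fin (d k)) ℂ)) = 1 := by
  ext x y
  rw [productOp_apply]
  by_cases h : x = y
  · subst h
    rw [Matrix.one_apply_eq]
    exact Finset.prod_eq_one fun k _ => Matrix.one_apply_eq _
  · obtain ⟨k, hk⟩ := Function.ne_iff.mp h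
    rw [Matrix.one_apply_ne h]
    exact Finset.prod_eq_zero (Finset.mem_univ k) (Matrix.one_apply_ne hk)

/-- The operator acting as `A` on the `k`-th factor and as the identity on the others. -/
def localOp (k : Fin N) (A : Matrix (Fin (d k)) (Fin (d k)) ℂ) : Matrix (PIdx d) (PIdx d) ℂ :=
  productOp (Function.update (fun _ => 1) k A)

theorem localOp_one (k : Fin N) : localOp (d := d) k 1 = 1 := by
  rw [localOp, ← productOp_one]
  congr 1
  exact Function.update_eq_self k _

theorem localOp_apply (k : Fin N) (A : Matrix (Fin (d k)) (Fin (d k)) ℂ) (x y : PIdx d) :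
    localOp k A x y = A (x k) (y k) *
      ∏ j ∈ Finset.univ.erase k, (1 : Matrix (Fin (d j)) (Fin (d j)) ℂ) (x j) (y j) := by
  rw [localOp, productOp_apply, ← Finset.mul_prod_erase _ _ (Finset.mem_univ k)]
  rw [Function.update_self]
  congr 1
  refine Finset.prod_congr rfl fun j hj => ?_
  rw [Function.update_of_ne (Finset.ne_of_mem_erase hj)]

theorem sum_localOp {ι : Type*} (s : Finset ι) (k : Fin N)
    (A : ι → Matrix (Fin (d k)) (Fin (d k)) ℂ) :
    ∑ i ∈ s, localOp k (A i) = localOp k (∑ i ∈ s, A i) := by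
  ext x y
  simp only [Matrix.sum_apply, localOp_apply, Finset.sum_mul]

end ProductOperators

/-! ### Building LOCC protocols from local measurements. -/

section LOCC

variable {N : ℕ} {O : Type} [DecidableEq O]

/-- In a round the isometries of the other parties cancel against their adjoints. What remains acts
on the measuring party only, where completeness applies. -/
theorem IsLOCC.sum_eq_one [Fintype O] {d : Fin N → ℕ} {M : O → Matrix (PIdx d) (PIdx d) ℂ}
    (h : IsLOCC d M) : ∑ o, M o = 1 := by
  induction h with
  | halt d o₀ => simp
  | round d k r d' B complete isometry M next ih =>
    rw [Finset.sum_comm]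
    have h1 : ∀ m, ∑ o, (productOp (B m))ᴴ * M m o * productOp (B m)
        = localOp k ((B m k)ᴴ * B m k) := by
      intro m
      rw [← Matrix.sum_mul, ← Matrix.mul_sum, ih m, Matrix.mul_one, productOp_conjTranspose,
        productOp_mul, localOp]
      congr 1
      funext j
      by_cases hj : j = k
      · subst hj; simp
      · rw [Function.update_of_ne hj, isometry m j hj]
    rw [Finset.sum_congr rfl fun m _ => h1 m, sum_localOp, complete, localOp_one]

/-- A measurement of one party which keeps the local dimensions, followed by a protocol that
depends on its result. -/
theorem IsLOCC.local_round {ι : Type*} [Fintype ι] {d : Fin N → ℕ} (k : Fin N)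
    (A : ι → Matrix (Fin (d k)) (Fin (d k)) ℂ) (hA : ∑ i, (A i)ᴴ * A i = 1)
    {M : ι → O → Matrix (PIdx d) (PIdx d) ℂ} (hM : ∀ i, IsLOCC d (M i)) :
    IsLOCC d (fun o => ∑ i, (localOp k (A i))ᴴ * M i o * localOp k (A i)) := by
  let f := (Fintype.equivFin ι).symm
  have h := IsLOCC.round d k (Fintype.card ι) (fun _ => d)
    (fun m => Function.update (fun _ => 1) k (A (f m)))
    (by simpa using (f.sum_comp fun i => (A i)ᴴ * A i).trans hA)
    (by intro m j hj; simp [hj]) (fun m => M (f m)) (fun m => hM (f m))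
  convert h using 2 with o
  exact (f.sum_comp fun i => (localOp k (A i))ᴴ * M i o * localOp k (A i)).symm

/-- A measurement of one party whose result is announced. -/
theorem IsLOCC.local_measurement [Fintype O] {d : Fin N → ℕ} (k : Fin N)
    (C : O → Matrix (Fin (d k)) (Fin (d k)) ℂ) (hC : ∑ o, (C o)ᴴ * C o = 1) :
    IsLOCC d (fun o => (localOp k (C o))ᴴ * localOp k (C o)) := by
  convert IsLOCC.local_round k C hC (fun i => IsLOCC.halt d i) using 2 with o
  rw [Finset.sum_eq_single o]
  · simp
  · intro i _ hi
    simp [hi.symm]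
  · simp

/-- The parties in `S` measure one after the other; then a protocol depending on their results is
run. The label `w₀` fills up the entries of those who do not measure. -/
theorem IsLOCC.local_rounds {d : Fin N → ℕ} {W : Fin N → Type*} [∀ k, Fintype (W k)]
    [∀ k, DecidableEq (W k)] (A : (k : Fin N) → W k → Matrix (Fin (d k)) (Fin (d k)) ℂ)
    (S : Finset (Fin N)) (hA : ∀ k ∈ S, ∑ i, (A k i)ᴴ * A k i = 1)
    (M : ((k : Fin N) → W k) → O → Matrix (PIdx d) (PIdx d) ℂ) (hM : ∀ w, IsLOCC d (M w))
    (w₀ : (k : Fin N) → W k) :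
    IsLOCC d (fun o => ∑ w ∈ Fintype.piFinset (fun k => if k ∈ S then Finset.univ else {w₀ k}),
      (productOp fun k => if k ∈ S then A k (w k) else 1)ᴴ * M w o *
        productOp fun k => if k ∈ S then A k (w k) else 1) := by
  induction S using Finset.induction_on generalizing w₀ with
  | empty =>
    convert hM w₀ using 2 with o
    simp [productOp_one]
  | insert a S ha ih =>
    have hAS : ∀ k ∈ S, ∑ i, (A k i)ᴴ * A k i = 1 := fun k hk =>
      hA k (Finset.mem_insert_of_mem hk)
    convert IsLOCC.local_round a (A a) (hA a (Finset.mem_insert_self a S))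
      (fun x => ih hAS (Function.update w₀ a x)) using 2 with o
    rw [← Finset.sum_fiberwise _ (fun w => w a)]
    refine Finset.sum_congr rfl fun x _ => ?_
    rw [Matrix.mul_sum, Matrix.sum_mul]
    -- Fixing the result `x` of party `a` leaves the index set for `S`, with `x` as the default
    -- entry at `a`.
    have hset : (Fintype.piFinset fun k => if k ∈ insert a S then Finset.univ else {w₀ k}).filter
          (fun w => w a = x) =
        Fintype.piFinset fun k => if k ∈ S then Finset.univ else {Function.update w₀ a x k} := by
      ext w
      simp only [Finset.mem_filter, Fintype.mem_piFinset]
      constructor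
      · rintro ⟨h, hx⟩ k
        by_cases hk : k ∈ S
        · simp [hk]
        · by_cases hka : k = a
          · subst hka; simp [hk, hx]
          · simpa [hk, hka] using h k
      · intro h
        refine ⟨fun k => ?_, by simpa [ha] using h a⟩
        by_cases hka : k = a
        · simp [hka]
        · by_cases hk : k ∈ S
          · simp [hk]
          · simpa [hk, hka] using h k
    rw [hset]
    refine Finset.sum_congr rfl fun w hw => ?_
    have hwa : w a = x := by simpa [ha] using Fintype.mem_piFinset.mp hw a
    -- Party `a` measures before those in `S`, so its operator stands on the right.
    have hop : (productOp fun k => if k ∈ insert a S then A k (w k) else 1) =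
        (productOp fun k => if k ∈ S then A k (w k) else 1) * localOp a (A a x) := by
      rw [localOp, productOp_mul]
      congr 1
      funext k
      by_cases hka : k = a
      · subst hka; simp [ha, hwa]
      · simp [hka]
    rw [hop, Matrix.conjTranspose_mul]
    simp only [Matrix.mul_assoc]

/-- The parties in `S` measure one after the other; then the party `l` performs a measurement
depending on their results, and announces its own result. -/
theorem IsLOCC.local_rounds_measurement [Fintype O] {d : Fin N → ℕ} {W : Fin N → Type*}
    [∀ k, Fintype (W k)] [∀ k, DecidableEq (W k)]
    (A : (k : Fin N) → W k → Matrix (Fin (d k)) (Fin (d k)) ℂ)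
    (S : Finset (Fin N)) (hA : ∀ k ∈ S, ∑ i, (A k i)ᴴ * A k i = 1) (l : Fin N) (hl : l ∉ S)
    (C : ((k : Fin N) → W k) → O → Matrix (Fin (d l)) (Fin (d l)) ℂ)
    (hC : ∀ w, ∑ o, (C w o)ᴴ * C w o = 1) (w₀ : (k : Fin N) → W k) :
    IsLOCC d (fun o => ∑ w ∈ Fintype.piFinset (fun k => if k ∈ S then Finset.univ else {w₀ k}),
      (productOp (Function.update (fun k => if k ∈ S then A k (w k) else 1) l (C w o)))ᴴ *
        productOp (Function.update (fun k => if k ∈ S then A k (w k) else 1) l (C w o))) := by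
  convert IsLOCC.local_rounds A S hA _ (fun w => IsLOCC.local_measurement l (C w) (hC w)) w₀
    using 2 with o
  refine Finset.sum_congr rfl fun w _ => ?_
  have hop : productOp (Function.update (fun k => if k ∈ S then A k (w k) else 1) l (C w o)) =
      localOp l (C w o) * productOp fun k => if k ∈ S then A k (w k) else 1 := by
    rw [localOp, productOp_mul]
    congr 1
    funext k
    by_cases hk : k = l
    · subst hk; simp [hl]
    · simp [hk]
  rw [hop, Matrix.conjTranspose_mul]
  simp only [Matrix.mul_assoc]

theorem expect_sum {ι : Type*} {d : Fin N → ℕ} (s : Finset ι)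
    (M : ι → Matrix (PIdx d) (PIdx d) ℂ) (v : PSpace d) :
    expect (∑ i ∈ s, M i) v = ∑ i ∈ s, expect (M i) v := by
  simp only [expect, Matrix.sum_mulVec, dotProduct_sum]

theorem expect_conjTranspose_mul_self {d : Fin N → ℕ} (T : Matrix (PIdx d) (PIdx d) ℂ)
    (v : PSpace d) : expect (Tᴴ * T) v = star (T *ᵥ v.ofLp) ⬝ᵥ (T *ᵥ v.ofLp) := by
  rw [expect, ← Matrix.mulVec_mulVec, Matrix.dotProduct_mulVec, Matrix.star_mulVec]

end LOCC

/-! ### Bell measurements. -/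

section BellMeasurement

/-- The Kraus operators `|0⟩⟨β|` of a measurement in the Bell basis of `ℂ^m ⊗ ℂ^m`, whose vectors
`β = m^(-1/2) ∑ b, χ b |b + p⟩ ⊗ |b⟩` are labelled by a character `χ` and a shift `p`. -/
noncomputable def bellKraus (m' m : ℕ) [NeZero m] (w : AddChar (Fin m) ℂ × Fin m) :
    Matrix (Fin (m' * m)) (Fin (m' * m)) ℂ :=
  Matrix.of fun y x =>
    if (y : ℕ) = 0 ∧ (x.divNat : ℕ) = ((x.modNat + w.2 : Fin m) : ℕ) then
      ((Real.sqrt m)⁻¹ : ℝ) * star (w.1 x.modNat) else 0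

theorem AddChar.mul_star_apply {G : Type*} [AddCommGroup G] [Finite G] (χ : AddChar G ℂ)
    (a b : G) : χ a * star (χ b) = χ (a - b) := by
  rw [sub_eq_add_neg, AddChar.map_add_eq_mul]
  congr 1
  exact (AddChar.map_neg_eq_conj χ b).symm

theorem ofReal_inv_sqrt_mul_self (m : ℕ) :
    (((Real.sqrt m)⁻¹ : ℝ) : ℂ) * (((Real.sqrt m)⁻¹ : ℝ) : ℂ) = (m : ℂ)⁻¹ := by
  rw [← Complex.ofReal_mul, ← mul_inv, Real.mul_self_sqrt (Nat.cast_nonneg m)]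
  simp

/-- Summing over characters forces equal second labels. Given these, exactly one shift matches the
first label, which forces equal first labels. The equality `h` is a hypothesis because it holds only
propositionally for `bellDim`. -/
theorem sum_bellKraus (m' m : ℕ) [NeZero m] (h : m' = m) :
    ∑ w, (bellKraus m' m w)ᴴ * bellKraus m' m w = 1 := by
  subst h
  have hm : (m' : ℂ) ≠ 0 := Nat.cast_ne_zero.mpr (NeZero.ne m')
  have hpos : 0 < m' * m' := Nat.mul_pos (NeZero.pos m') (NeZero.pos m')
  -- Only row `0` of the Kraus operator is nonzero, so the product has a single term.
  have hentry : ∀ (w : AddChar (Fin m') ℂ × Fin m') (x x' : Fin (m' * m')),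
      ((bellKraus m' m' w)ᴴ * bellKraus m' m' w) x x' =
        (if x.divNat = x.modNat + w.2 ∧ x'.divNat = x'.modNat + w.2 then (m' : ℂ)⁻¹ else 0) *
          w.1 (x.modNat - x'.modNat) := by
    intro w x x'
    rw [Matrix.mul_apply, Finset.sum_eq_single (⟨0, hpos⟩ : Fin (m' * m'))]
    · rw [Matrix.conjTranspose_apply, bellKraus, Matrix.of_apply, Matrix.of_apply]
      simp only [true_and, Fin.val_inj]
      by_cases h1 : x.divNat = x.modNat + w.2
      · by_cases h2 : x'.divNat = x'.modNat + w.2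
        · rw [if_pos h1, if_pos h2, if_pos ⟨h1, h2⟩, ← AddChar.mul_star_apply,
            ← ofReal_inv_sqrt_mul_self, star_mul', star_star]
          simp only [Complex.star_def, Complex.conj_ofReal]
          ring
        · rw [if_neg h2, if_neg fun hh : _ ∧ _ => h2 hh.2, mul_zero, zero_mul]
      · rw [if_neg h1, if_neg fun hh : _ ∧ _ => h1 hh.1, star_zero, zero_mul, zero_mul]
    · intro y _ hy
      have hy0 : (y : ℕ) ≠ 0 := fun hh => hy (Fin.ext hh)
      rw [bellKraus, Matrix.of_apply, if_neg fun hh => hy0 hh.1, mul_zero]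
    · simp
  ext x x'
  rw [Matrix.sum_apply, Finset.sum_congr rfl fun w _ => hentry w x x', Fintype.sum_prod_type_right]
  have hχ : ∑ χ : AddChar (Fin m') ℂ, χ (x.modNat - x'.modNat) =
      if x.modNat = x'.modNat then (m' : ℂ) else 0 := by
    rw [AddChar.sum_apply_eq_ite, Fintype.card_fin]
    simp only [sub_eq_zero]
  refine (Finset.sum_congr rfl fun p _ => (Finset.mul_sum Finset.univ
    (fun χ : AddChar (Fin m') ℂ => χ (x.modNat - x'.modNat))
    (if x.divNat = x.modNat + p ∧ x'.divNat = x'.modNat + p then (m' : ℂ)⁻¹ else 0)).symm).trans ?_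
  rw [hχ, ← Finset.sum_mul]
  by_cases hb : x.modNat = x'.modNat
  · rw [if_pos hb, Finset.sum_eq_single (x.divNat - x.modNat)]
    · rw [hb]
      by_cases ha : x.divNat = x'.divNat
      · have hx : x = x' := finProdFinEquiv.symm.injective (Prod.ext ha hb)
        subst hx
        simp [hm]
      · have hx : x ≠ x' := fun hh => ha (hh ▸ rfl)
        rw [Matrix.one_apply_ne hx, if_neg, zero_mul]
        rintro ⟨h1, h2⟩
        exact ha (h1.trans h2.symm)
    · intro p _ hp
      rw [if_neg]
      rintro ⟨h1, -⟩
      exact hp (by rw [h1]; abel)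
    · simp
  · have hx : x ≠ x' := fun hh => hb (hh ▸ rfl)
    rw [if_neg hb, Matrix.one_apply_ne hx, mul_zero]

end BellMeasurement

/-! ### Teleportation to the last party. -/

section Teleportation

variable {n : ℕ} (d : Fin (n + 1) → ℕ)
  (e : ((k : Fin n) → Fin (d k.castSucc)) ≃ Fin (∏ k : Fin n, d k.castSucc))

/-- The amplitude of the resource state. -/
noncomputable def bellAmplitude : ℝ :=
  Real.sqrt ((d (Fin.last n) : ℝ) / ((∏ k, d k : ℕ) : ℝ))

theorem bellState_apply (a : PIdx (bellDim d)) : bellState d e a =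
    if e (fun k => Fin.cast (bellDim_castSucc d k) (a k.castSucc)) =
      Fin.cast (bellDim_last d) (a (Fin.last n)) then (bellAmplitude d : ℂ) else 0 := rfl

/-- The label `a` of the resource for which `|a⟩ ⊗ |b⟩` passes the Bell measurements with
shifts `p`. -/
def resourceIdx (p b : PIdx d) : PIdx (bellDim d) :=
  Fin.lastCases (Fin.cast (bellDim_last d).symm (e fun k => b k.castSucc + p k.castSucc))
    fun k => Fin.cast (bellDim_castSucc d k).symm (b k.castSucc + p k.castSucc)

theorem resourceIdx_last (p b : PIdx d) : resourceIdx d e p b (Fin.last n) =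
    Fin.cast (bellDim_last d).symm (e fun k => b k.castSucc + p k.castSucc) := by
  simp [resourceIdx]

theorem resourceIdx_castSucc (p b : PIdx d) (k : Fin n) : resourceIdx d e p b k.castSucc =
    Fin.cast (bellDim_castSucc d k).symm (b k.castSucc + p k.castSucc) := by
  simp [resourceIdx]

/-- The label `|a⟩ ⊗ |b⟩` with `a = resourceIdx d e p b`. -/
def jointIdx (p b : PIdx d) : PIdx (fun k => bellDim d k * d k) :=
  fun k => finProdFinEquiv (resourceIdx d e p b k, b k)

theorem jointIdx_divNat (p b : PIdx d) (k : Fin (n + 1)) :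
    (jointIdx d e p b k).divNat = resourceIdx d e p b k :=
  congrArg Prod.fst (finProdFinEquiv.symm_apply_apply (resourceIdx d e p b k, b k))

theorem jointIdx_modNat (p b : PIdx d) (k : Fin (n + 1)) :
    (jointIdx d e p b k).modNat = b k :=
  congrArg Prod.snd (finProdFinEquiv.symm_apply_apply (resourceIdx d e p b k, b k))

theorem bellState_resourceIdx (p b : PIdx d) :
    bellState d e (resourceIdx d e p b) = bellAmplitude d := by
  rw [bellState_apply, if_pos]
  rw [resourceIdx_last]
  simp only [resourceIdx_castSucc]
  rfl

variable [∀ k, NeZero (d k)]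

/-- The label held by the last party after teleportation with shifts `p`. -/
def teleportEquiv (p : PIdx d) :
    PIdx d ≃ Fin (bellDim d (Fin.last n) * d (Fin.last n)) :=
  (Fin.snocEquiv fun k => Fin (d k)).symm.trans <|
    (Equiv.prodCongr (Equiv.refl _) ((Equiv.addRight fun k : Fin n => p k.castSucc).trans
      (e.trans (finCongr (bellDim_last d).symm)))).trans <|
    (Equiv.prodComm _ _).trans finProdFinEquiv

theorem jointIdx_last (p b : PIdx d) :
    jointIdx d e p b (Fin.last n) = teleportEquiv d e p b := by
  rw [jointIdx, resourceIdx_last]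
  rfl

/-- The Kraus operators of the teleportation protocol: Bell measurements of all parties but the
last, and `C` for the last. -/
noncomputable def teleportOp (w : (k : Fin (n + 1)) → AddChar (Fin (d k)) ℂ × Fin (d k))
    (C : Matrix (Fin (bellDim d (Fin.last n) * d (Fin.last n)))
      (Fin (bellDim d (Fin.last n) * d (Fin.last n))) ℂ) :
    Matrix (PIdx fun k => bellDim d k * d k) (PIdx fun k => bellDim d k * d k) ℂ :=
  productOp (d := fun k => bellDim d k * d k) (d' := fun k => bellDim d k * d k)
    (Function.update (fun k => if k ∈ Finset.univ.erase (Fin.last n) then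
      bellKraus (bellDim d k) (d k) (w k) else 1) (Fin.last n) C)

theorem teleportOp_apply (w : (k : Fin (n + 1)) → AddChar (Fin (d k)) ℂ × Fin (d k))
    (C : Matrix (Fin (bellDim d (Fin.last n) * d (Fin.last n)))
      (Fin (bellDim d (Fin.last n) * d (Fin.last n))) ℂ)
    (y x : PIdx fun k => bellDim d k * d k) :
    teleportOp d w C y x = (∏ k : Fin n, bellKraus (bellDim d k.castSucc) (d k.castSucc)
      (w k.castSucc) (y k.castSucc) (x k.castSucc)) * C (y (Fin.last n)) (x (Fin.last n)) := by
  rw [teleportOp, productOp_apply, Fin.prod_univ_castSucc, Function.update_self]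
  congr 1
  refine Finset.prod_congr rfl fun k _ => ?_
  rw [Function.update_of_ne (Fin.castSucc_ne_last k), if_pos]
  simp [Fin.castSucc_ne_last]

/-- The factor by which each Bell outcome scales the teleported state. -/
noncomputable def teleportScale : ℝ :=
  bellAmplitude d * ∏ k : Fin n, (Real.sqrt (d k.castSucc))⁻¹

/-- The Bell results force each resource label to be `b k + p k`, and the resource state then fixes
the last one. So exactly one joint label survives for each `b`, and the last party's part of it
already determines `b`. -/
theorem teleportOp_mulVec (w : (k : Fin (n + 1)) → AddChar (Fin (d k)) ℂ × Fin (d k))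
    (C : Matrix (Fin (bellDim d (Fin.last n) * d (Fin.last n)))
      (Fin (bellDim d (Fin.last n) * d (Fin.last n))) ℂ)
    (ψ : PSpace d) (y : PIdx fun k => bellDim d k * d k) :
    (teleportOp d w C *ᵥ (tensorState (bellState d e) ψ).ofLp) y =
      if ∀ k : Fin n, (y k.castSucc : ℕ) = 0 then
        teleportScale d * ∑ b, C (y (Fin.last n)) (teleportEquiv d e (fun k => (w k).2) b) *
          (∏ k : Fin n, star ((w k.castSucc).1 (b k.castSucc))) * ψ b
      else 0 := by
  set p : PIdx d := fun k => (w k).2 with hp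
  have hterm : ∀ x, (tensorState (bellState d e) ψ).ofLp x =
      bellState d e (fun k => (x k).divNat) * ψ (fun k => (x k).modNat) := fun _ => rfl
  split_ifs with hy
  · rw [Matrix.mulVec, dotProduct, Finset.mul_sum]
    symm
    refine Finset.sum_of_injOn (jointIdx d e p) ?_
      (fun _ _ => Finset.mem_coe.mpr (Finset.mem_univ _)) ?_ ?_
    · intro b _ b' _ hb
      funext k
      rw [← jointIdx_modNat d e p b, hb, jointIdx_modNat]
    -- A nonzero term satisfies both the Bell and the resource constraints, hence comes from
    -- `jointIdx`.
    · intro x _ hx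
      by_contra hne
      apply hx
      refine ⟨fun k => (x k).modNat, Finset.mem_coe.mpr (Finset.mem_univ _), ?_⟩
      rw [hterm, teleportOp_apply] at hne
      have hK := left_ne_zero_of_mul (left_ne_zero_of_mul hne)
      have hB := left_ne_zero_of_mul (right_ne_zero_of_mul hne)
      have hdiv : ∀ k : Fin n, Fin.cast (bellDim_castSucc d k) (x k.castSucc).divNat =
          (x k.castSucc).modNat + p k.castSucc := by
        intro k
        have := Finset.prod_ne_zero_iff.mp hK k (Finset.mem_univ k)
        rw [bellKraus, Matrix.of_apply] at this
        exact Fin.ext (ite_ne_right_iff.mp this).1.2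
      rw [bellState_apply] at hB
      have hlast := (ite_ne_right_iff.mp hB).1
      simp only [hdiv] at hlast
      have hres : resourceIdx d e p (fun k => (x k).modNat) = fun k => (x k).divNat := by
        funext k
        refine Fin.lastCases ?_ (fun k => ?_) k
        · rw [resourceIdx_last, hlast]; rfl
        · rw [resourceIdx_castSucc, ← hdiv]; rfl
      funext k
      rw [jointIdx, hres]
      exact finProdFinEquiv.apply_symm_apply (x k)
    · intro b _
      rw [hterm, teleportOp_apply]
      simp only [jointIdx_divNat, jointIdx_modNat, jointIdx_last]
      have hK : ∀ k : Fin n, bellKraus (bellDim d k.castSucc) (d k.castSucc)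
          (w k.castSucc) (y k.castSucc) (jointIdx d e p b k.castSucc) =
          ((Real.sqrt (d k.castSucc))⁻¹ : ℝ) * star ((w k.castSucc).1 (b k.castSucc)) := by
        intro k
        rw [bellKraus, Matrix.of_apply, jointIdx_divNat, jointIdx_modNat, resourceIdx_castSucc,
          if_pos ⟨hy k, rfl⟩]
      have hB : bellState d e (fun k => resourceIdx d e p b k) = bellAmplitude d :=
        bellState_resourceIdx d e p b
      rw [Finset.prod_congr rfl fun k _ => hK k, Finset.prod_mul_distrib, hB, teleportScale]
      push_cast
      ring
  · push Not at hy
    obtain ⟨k, hk⟩ := hy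
    rw [Matrix.mulVec, dotProduct]
    refine Finset.sum_eq_zero fun x _ => ?_
    rw [teleportOp_apply, Finset.prod_eq_zero (Finset.mem_univ k), zero_mul, zero_mul]
    simp [bellKraus, hk]

/-- The phases produced by the Bell outcomes `w`. -/
noncomputable def teleportPhase (w : (k : Fin (n + 1)) → AddChar (Fin (d k)) ℂ × Fin (d k))
    (b : PIdx d) : ℂ :=
  ∏ k : Fin n, (w k.castSucc).1 (b k.castSucc)

theorem teleportPhase_mul_star (w : (k : Fin (n + 1)) → AddChar (Fin (d k)) ℂ × Fin (d k))
    (b : PIdx d) : teleportPhase d w b * ∏ k : Fin n, star ((w k.castSucc).1 (b k.castSucc)) = 1 := by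
  rw [teleportPhase, ← Finset.prod_mul_distrib]
  refine Finset.prod_eq_one fun k _ => ?_
  rw [AddChar.mul_star_apply, sub_self, AddChar.map_zero_eq_one]

/-- The operator `C` on the original system, as applied by the last party to the teleported
system after undoing the effect of the Bell outcomes `w`. -/
noncomputable def correctedOp (w : (k : Fin (n + 1)) → AddChar (Fin (d k)) ℂ × Fin (d k))
    (C : Matrix (PIdx d) (PIdx d) ℂ) :
    Matrix (Fin (bellDim d (Fin.last n) * d (Fin.last n)))
      (Fin (bellDim d (Fin.last n) * d (Fin.last n))) ℂ :=
  (C * Matrix.diagonal (teleportPhase d w)).submatrix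
    (teleportEquiv d e fun k => (w k).2).symm (teleportEquiv d e fun k => (w k).2).symm

/-- The correction is a diagonal unitary followed by a relabelling of the basis, so completeness
survives. -/
theorem sum_correctedOp {O : Type*} [Fintype O]
    (w : (k : Fin (n + 1)) → AddChar (Fin (d k)) ℂ × Fin (d k))
    (C : O → Matrix (PIdx d) (PIdx d) ℂ) (hC : ∑ o, (C o)ᴴ * C o = 1) :
    ∑ o, (correctedOp d e w (C o))ᴴ * correctedOp d e w (C o) = 1 := by
  have hD : (Matrix.diagonal (teleportPhase d w))ᴴ * Matrix.diagonal (teleportPhase d w) = 1 := by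
    rw [Matrix.diagonal_conjTranspose, Matrix.diagonal_mul_diagonal, ← Matrix.diagonal_one]
    congr 1
    funext b
    rw [mul_comm, ← teleportPhase_mul_star d w b, Pi.star_apply, teleportPhase, star_prod]
  have h1 : ∀ o, (correctedOp d e w (C o))ᴴ * correctedOp d e w (C o) =
      ((Matrix.diagonal (teleportPhase d w))ᴴ * ((C o)ᴴ * C o) *
        Matrix.diagonal (teleportPhase d w)).submatrix
          (teleportEquiv d e fun k => (w k).2).symm (teleportEquiv d e fun k => (w k).2).symm := by
    intro o
    rw [correctedOp, Matrix.conjTranspose_submatrix, Matrix.submatrix_mul_equiv,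
      Matrix.conjTranspose_mul]
    simp only [Matrix.mul_assoc]
  have h2 : ∑ o, ((Matrix.diagonal (teleportPhase d w))ᴴ * ((C o)ᴴ * C o) *
        Matrix.diagonal (teleportPhase d w)) = 1 := by
    rw [← Matrix.sum_mul, ← Matrix.mul_sum, hC, Matrix.mul_one, hD]
  rw [Finset.sum_congr rfl fun o _ => h1 o]
  ext z z'
  rw [Matrix.sum_apply]
  simp only [Matrix.submatrix_apply]
  rw [← Matrix.sum_apply, h2, Matrix.one_apply, Matrix.one_apply]
  simp

theorem teleportOp_correctedOp_mulVec
    (w : (k : Fin (n + 1)) → AddChar (Fin (d k)) ℂ × Fin (d k))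
    (C : Matrix (PIdx d) (PIdx d) ℂ) (ψ : PSpace d) (y : PIdx fun k => bellDim d k * d k) :
    (teleportOp d w (correctedOp d e w C) *ᵥ (tensorState (bellState d e) ψ).ofLp) y =
      if ∀ k : Fin n, (y k.castSucc : ℕ) = 0 then
        teleportScale d *
          (C *ᵥ ψ.ofLp) ((teleportEquiv d e fun k => (w k).2).symm (y (Fin.last n)))
      else 0 := by
  rw [teleportOp_mulVec]
  refine if_congr Iff.rfl (congrArg _ ?_) rfl
  rw [Matrix.mulVec, dotProduct]
  refine Finset.sum_congr rfl fun b _ => ?_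
  rw [correctedOp, Matrix.submatrix_apply, Equiv.symm_apply_apply, Matrix.mul_diagonal,
    mul_assoc (C _ _), teleportPhase_mul_star, mul_one]

theorem expect_teleportOp (w : (k : Fin (n + 1)) → AddChar (Fin (d k)) ℂ × Fin (d k))
    (C : Matrix (PIdx d) (PIdx d) ℂ) (ψ : PSpace d) :
    expect ((teleportOp d w (correctedOp d e w C))ᴴ * teleportOp d w (correctedOp d e w C))
      (tensorState (bellState d e) ψ) = (teleportScale d : ℂ) ^ 2 * expect (Cᴴ * C) ψ := by
  rw [expect_conjTranspose_mul_self, expect_conjTranspose_mul_self, dotProduct, dotProduct,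
    Finset.mul_sum]
  have hpos : ∀ k, 0 < bellDim d k * d k := by
    intro k
    refine Nat.mul_pos ?_ (NeZero.pos _)
    refine Fin.lastCases ?_ (fun k => ?_) k
    · rw [bellDim_last]; exact Finset.prod_pos fun k _ => NeZero.pos _
    · rw [bellDim_castSucc]; exact NeZero.pos _
  set g := teleportEquiv d e fun k => (w k).2
  symm
  -- The output is supported on labels that vanish for all parties but the last, so the sum reduces
  -- to the last party's label.
  refine Finset.sum_of_injOn
    (fun b => Function.update (fun k => (⟨0, hpos k⟩ : Fin (bellDim d k * d k)))
      (Fin.last n) (g b)) ?_ (fun _ _ => Finset.mem_coe.mpr (Finset.mem_univ _)) ?_ ?_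
  · intro b _ b' _ hb
    have := congrFun hb (Fin.last n)
    simpa using this
  · intro y _ hy
    rw [teleportOp_correctedOp_mulVec, if_neg, mul_zero]
    intro h0
    refine hy ⟨g.symm (y (Fin.last n)), Finset.mem_coe.mpr (Finset.mem_univ _), ?_⟩
    funext k
    refine Fin.lastCases ?_ (fun k => ?_) k
    · simp
    · simp only [Function.update_of_ne (Fin.castSucc_ne_last k)]
      exact Fin.ext (h0 k).symm
  · intro b _
    rw [Pi.star_apply, Pi.star_apply, teleportOp_correctedOp_mulVec, if_pos]
    · rw [Function.update_self, Equiv.symm_apply_apply, star_mul']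
      simp only [Complex.star_def, Complex.conj_ofReal]
      ring
    · intro k
      rw [Function.update_of_ne (Fin.castSucc_ne_last k)]

/-- All Bell results are equally likely, and party `k` has `d k` characters times `d k` shifts. -/
theorem card_mul_teleportScale_sq :
    ((∏ k : Fin n, (d k.castSucc * d k.castSucc) : ℕ) : ℂ) * (teleportScale d : ℂ) ^ 2 = 1 := by
  have hd : ∀ k, (d k : ℝ) ≠ 0 := fun k => Nat.cast_ne_zero.mpr (NeZero.ne _)
  have hP : (∏ k : Fin n, (d k.castSucc : ℝ)) ≠ 0 := Finset.prod_ne_zero_iff.mpr fun k _ => hd _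
  have h : ((∏ k : Fin n, (d k.castSucc * d k.castSucc) : ℕ) : ℝ) * teleportScale d ^ 2 = 1 := by
    rw [teleportScale, mul_pow, bellAmplitude, Real.sq_sqrt (by positivity), ← Finset.prod_pow]
    simp only [inv_pow, Real.sq_sqrt (Nat.cast_nonneg _)]
    rw [Fin.prod_univ_castSucc, Finset.prod_inv_distrib]
    push_cast
    rw [Finset.prod_mul_distrib]
    have := hd (Fin.last n)
    field_simp
  exact_mod_cast congrArg (fun r : ℝ => (r : ℂ)) h

/-- With the resource `bellState d e`, every measurement of the whole system can be implemented
with LOCC. -/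
theorem exists_isLOCC_expect_eq {O : Type} [Fintype O] [DecidableEq O]
    (C : O → Matrix (PIdx d) (PIdx d) ℂ) (hC : ∑ o, (C o)ᴴ * C o = 1) :
    ∃ M : O → Matrix (PIdx fun k => bellDim d k * d k) (PIdx fun k => bellDim d k * d k) ℂ,
      IsLOCC (fun k => bellDim d k * d k) M ∧ ∑ o, M o = 1 ∧
      ∀ o ψ, expect (M o) (tensorState (bellState d e) ψ) = expect ((C o)ᴴ * C o) ψ := by
  classical
  have hL := IsLOCC.local_rounds_measurement (d := fun k => bellDim d k * d k)
    (W := fun k => AddChar (Fin (d k)) ℂ × Fin (d k))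
    (fun k => bellKraus (bellDim d k) (d k)) (Finset.univ.erase (Fin.last n))
    (by
      intro k hk
      obtain ⟨j, rfl⟩ := Fin.exists_castSucc_eq.mpr (Finset.ne_of_mem_erase hk)
      exact sum_bellKraus _ _ (bellDim_castSucc d j))
    (Fin.last n) (Finset.notMem_erase _ _) (fun w o => correctedOp d e w (C o))
    -- The default `0` serves only as the last party's entry, on which neither the phases nor the
    -- relabelling depend.
    (fun w => sum_correctedOp d e w C hC) (fun _ => 0)
  refine ⟨_, hL, hL.sum_eq_one, fun o ψ => ?_⟩
  rw [expect_sum]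
  have h1 : ∀ w : (k : Fin (n + 1)) → AddChar (Fin (d k)) ℂ × Fin (d k), expect
      ((teleportOp d w (correctedOp d e w (C o)))ᴴ * teleportOp d w (correctedOp d e w (C o)))
      (tensorState (bellState d e) ψ) = (teleportScale d : ℂ) ^ 2 * expect ((C o)ᴴ * C o) ψ :=
    fun w => expect_teleportOp d e w (C o) ψ
  refine (Finset.sum_congr rfl fun w _ => h1 w).trans ?_
  rw [Finset.sum_const, nsmul_eq_mul, ← mul_assoc, Fintype.card_piFinset, Fin.prod_univ_castSucc]
  have hcard : ∀ k, Fintype.card (AddChar (Fin (d k)) ℂ × Fin (d k)) = d k * d k := by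
    intro k
    rw [Fintype.card_prod, AddChar.card_eq, Fintype.card_fin]
  simp only [Finset.mem_erase, Fin.castSucc_ne_last, ne_eq, not_false_eq_true, Finset.mem_univ,
    and_self, if_true, not_true_eq_false, false_and, if_false, Finset.card_singleton, mul_one,
    Finset.card_univ, hcard]
  rw [card_mul_teleportScale_sq, one_mul]

theorem norm_bellState : ‖bellState d e‖ = 1 := by
  have hd : ∀ k, (d k : ℝ) ≠ 0 := fun k => Nat.cast_ne_zero.mpr (NeZero.ne _)
  have hP : (∏ k : Fin n, (d k.castSucc : ℝ)) ≠ 0 := Finset.prod_ne_zero_iff.mpr fun k _ => hd _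
  have h : ‖bellState d e‖ ^ 2 = 1 := by
    rw [EuclideanSpace.norm_sq_eq]
    have hsum : ∑ _c : (k : Fin n) → Fin (d k.castSucc), bellAmplitude d ^ 2 =
        ∑ a, ‖bellState d e a‖ ^ 2 := by
      -- The first `n` labels parametrise the support. The appended `0` is a dummy, since
      -- `resourceIdx` ignores the last entry.
      refine Finset.sum_of_injOn
        (fun c => resourceIdx d e 0 (Fin.snoc (α := fun k => Fin (d k)) c 0)) ?_
        (fun _ _ => Finset.mem_coe.mpr (Finset.mem_univ _)) ?_ ?_
      · intro c _ c' _ hc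
        funext k
        have := congrFun hc k.castSucc
        simpa [resourceIdx_castSucc] using this
      · intro a _ ha
        rw [bellState_apply, if_neg]
        · simp
        · intro hlast
          refine ha ⟨fun k => Fin.cast (bellDim_castSucc d k) (a k.castSucc),
            Finset.mem_coe.mpr (Finset.mem_univ _), ?_⟩
          funext k
          refine Fin.lastCases ?_ (fun k => ?_) k
          · simp [resourceIdx_last, hlast]
          · simp [resourceIdx_castSucc]
      · intro c _
        rw [bellState_resourceIdx, Complex.norm_real, Real.norm_eq_abs, sq_abs]
    rw [← hsum, Finset.sum_const, Finset.card_univ, Fintype.card_pi, nsmul_eq_mul, bellAmplitude,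
      Real.sq_sqrt (by positivity), Fin.prod_univ_castSucc]
    simp only [Fintype.card_fin]
    push_cast
    have := hd (Fin.last n)
    field_simp
  nlinarith [norm_nonneg (bellState d e)]

end Teleportation

/-! ### Positive operators and dual families. -/

section Measurements

open scoped ComplexOrder

variable {N : ℕ} {d : Fin N → ℕ}

/-- The rank-one operator `|u⟩⟨u|`. -/
def rankOne (u : PSpace d) : Matrix (PIdx d) (PIdx d) ℂ :=
  Matrix.vecMulVec u.ofLp (star u.ofLp)

theorem expect_rankOne (u v : PSpace d) :
    expect (rankOne u) v = ((‖inner ℂ u v‖ ^ 2 : ℝ) : ℂ) := by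
  rw [expect, rankOne, Matrix.vecMulVec_mulVec, dotProduct_comm]
  have h1 : star u.ofLp ⬝ᵥ v.ofLp = inner ℂ u v := by
    rw [EuclideanSpace.inner_eq_star_dotProduct, dotProduct_comm]
  have h2 : u.ofLp ⬝ᵥ star v.ofLp = star (inner ℂ u v) := by
    rw [← h1, Matrix.star_dotProduct, star_star, dotProduct_comm]
  rw [h1, op_smul_eq_smul, smul_dotProduct, h2, smul_eq_mul, Complex.star_def,
    Complex.mul_conj, Complex.normSq_eq_norm_sq]

theorem expect_one (v : PSpace d) : expect 1 v = ((‖v‖ ^ 2 : ℝ) : ℂ) := by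
  rw [expect, Matrix.one_mulVec, dotProduct_comm, ← EuclideanSpace.inner_eq_star_dotProduct,
    inner_self_eq_norm_sq_to_K]
  simp

theorem expect_add (A B : Matrix (PIdx d) (PIdx d) ℂ) (v : PSpace d) :
    expect (A + B) v = expect A v + expect B v := by
  simp only [expect, Matrix.add_mulVec, dotProduct_add]

theorem expect_one_sub_sum_rankOne {m : ℕ} (χ : Fin m → PSpace d) (v : PSpace d) :
    expect (1 - ∑ i, rankOne (χ i)) v =
      ((‖v‖ ^ 2 - ∑ i, ‖inner ℂ (χ i) v‖ ^ 2 : ℝ) : ℂ) := by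
  have h := expect_add (1 - ∑ i, rankOne (χ i)) (∑ i, rankOne (χ i)) v
  rw [sub_add_cancel, expect_one, expect_sum,
    Finset.sum_congr rfl fun i _ => expect_rankOne (χ i) v] at h
  rw [Complex.ofReal_sub, Complex.ofReal_sum, h, add_sub_cancel_right]

theorem posSemidef_rankOne (u : PSpace d) : (rankOne u).PosSemidef :=
  Matrix.posSemidef_vecMulVec_self_star _

theorem posSemidef_one_sub_sum_rankOne {m : ℕ} (χ : Fin m → PSpace d)
    (h : ∀ v, ∑ i, ‖inner ℂ (χ i) v‖ ^ 2 ≤ ‖v‖ ^ 2) :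
    (1 - ∑ i, rankOne (χ i)).PosSemidef := by
  refine Matrix.PosSemidef.of_dotProduct_mulVec_nonneg ?_ fun x => ?_
  · refine Matrix.isHermitian_one.sub ?_
    rw [Matrix.IsHermitian, Matrix.conjTranspose_sum]
    exact Finset.sum_congr rfl fun i _ => (posSemidef_rankOne (χ i)).1
  · have := expect_one_sub_sum_rankOne χ (WithLp.toLp 2 x)
    rw [expect] at this
    rw [this]
    exact_mod_cast sub_nonneg.mpr (h _)

-- This turns the effects of a POVM into Kraus operators, which the protocol requires.
open scoped MatrixOrder Matrix.Norms.L2Operator in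
theorem Matrix.PosSemidef.exists_conjTranspose_mul_self {ι : Type*} [Fintype ι] [DecidableEq ι]
    {E : Matrix ι ι ℂ} (hE : E.PosSemidef) : ∃ C : Matrix ι ι ℂ, E = Cᴴ * C :=
  CStarAlgebra.nonneg_iff_eq_star_mul_self.mp hE.nonneg

/-- The coordinate functionals of a left inverse of the linear combination map are represented by
vectors through the Riesz theorem. -/
theorem LinearIndependent.exists_dual {ι E : Type*} [Fintype ι] [DecidableEq ι]
    [NormedAddCommGroup E] [InnerProductSpace ℂ E] [FiniteDimensional ℂ E] {v : ι → E}
    (hv : LinearIndependent ℂ v) :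
    ∃ χ : ι → E, ∀ i j, inner ℂ (χ i) (v j) = if i = j then 1 else 0 := by
  obtain ⟨g, hg⟩ := (Fintype.linearCombination ℂ v).exists_leftInverse_of_injective
    (LinearMap.ker_eq_bot.mpr hv.fintypeLinearCombination_injective)
  refine ⟨fun i => (InnerProductSpace.toDual ℂ E).symm
    (LinearMap.toContinuousLinearMap (LinearMap.proj i ∘ₗ g)), fun i j => ?_⟩
  have h := LinearMap.congr_fun hg (Pi.single j 1)
  rw [LinearMap.comp_apply, Fintype.linearCombination_apply_single, one_smul] at h
  rw [InnerProductSpace.toDual_symm_apply]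
  simp [h, Pi.single_apply]

end Measurements

/-! ### The two discrimination problems. -/

section Universality

open scoped ComplexOrder

variable {n : ℕ} (d : Fin (n + 1) → ℕ) [∀ k, NeZero (d k)]
  (e : ((k : Fin n) → Fin (d k.castSucc)) ≃ Fin (∏ k : Fin n, d k.castSucc))

theorem exists_isLOCC_of_posSemidef {O : Type} [Fintype O] [DecidableEq O]
    (E : O → Matrix (PIdx d) (PIdx d) ℂ)
    (hE : ∀ o, (E o).PosSemidef) (hsum : ∑ o, E o = 1) :
    ∃ M : O → Matrix (PIdx fun k => bellDim d k * d k) (PIdx fun k => bellDim d k * d k) ℂ,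
      IsLOCC (fun k => bellDim d k * d k) M ∧ ∑ o, M o = 1 ∧
      ∀ o ψ, expect (M o) (tensorState (bellState d e) ψ) = expect (E o) ψ := by
  choose C hC using fun o => (hE o).exists_conjTranspose_mul_self
  simp only [hC] at hsum ⊢
  exact exists_isLOCC_expect_eq d e C hsum

theorem universalUnambiguous_bellState : UniversalUnambiguous d (bellState d e) := by
  refine ⟨norm_bellState d e, fun m ψ _ hli => ?_⟩
  obtain ⟨χ, hχ⟩ := hli.exists_dual
  -- By Cauchy–Schwarz, dividing by the sum of the `‖χ i‖ ^ 2` would suffice. The summand `1` keeps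
  -- `K` positive even for an empty family.
  set K : ℝ := 1 + ∑ i, ‖χ i‖ ^ 2 with hK
  have hKpos : 0 < K := by positivity
  set c : ℝ := (Real.sqrt K)⁻¹ with hc
  have hcsq : c ^ 2 = K⁻¹ := by rw [hc, inv_pow, Real.sq_sqrt hKpos.le]
  have hinner : ∀ i v, ‖inner ℂ ((c : ℂ) • χ i) v‖ ^ 2 = K⁻¹ * ‖inner ℂ (χ i) v‖ ^ 2 := by
    intro i v
    rw [inner_smul_left, norm_mul, mul_pow, Complex.conj_ofReal, Complex.norm_real,
      Real.norm_eq_abs, sq_abs, hcsq]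
  have hbound : ∀ v, ∑ i, ‖inner ℂ ((c : ℂ) • χ i) v‖ ^ 2 ≤ ‖v‖ ^ 2 := by
    intro v
    rw [Finset.sum_congr rfl fun i _ => hinner i v, ← Finset.mul_sum, inv_mul_le_iff₀ hKpos]
    calc ∑ i, ‖inner ℂ (χ i) v‖ ^ 2 ≤ ∑ i, ‖χ i‖ ^ 2 * ‖v‖ ^ 2 :=
          Finset.sum_le_sum fun i _ => by
            rw [← mul_pow]
            exact pow_le_pow_left₀ (norm_nonneg _) (norm_inner_le_norm _ _) 2
      _ = (∑ i, ‖χ i‖ ^ 2) * ‖v‖ ^ 2 := (Finset.sum_mul _ _ _).symm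
      _ ≤ K * ‖v‖ ^ 2 := mul_le_mul_of_nonneg_right (by rw [hK]; linarith) (sq_nonneg _)
  obtain ⟨M, hM, hsum, hexp⟩ := exists_isLOCC_of_posSemidef d e
    (fun o : Option (Fin m) => o.elim (1 - ∑ i, rankOne ((c : ℂ) • χ i))
      fun i => rankOne ((c : ℂ) • χ i))
    (by
      rintro (_ | i)
      · exact posSemidef_one_sub_sum_rankOne _ hbound
      · exact posSemidef_rankOne _)
    (by simp [Fintype.sum_option])
  refine ⟨M, hM, hsum, fun _ => K⁻¹, fun _ => inv_pos.mpr hKpos, fun i j => ?_⟩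
  rw [hexp, Option.elim_some, expect_rankOne, hinner, hχ]
  split_ifs <;> simp

theorem universalPerfect_bellState : UniversalPerfect d (bellState d e) := by
  refine ⟨norm_bellState d e, fun m ψ hm hψ => ?_⟩
  have hR := posSemidef_one_sub_sum_rankOne ψ fun v => hψ.sum_inner_products_le v
  obtain ⟨M, hM, hsum, hexp⟩ := exists_isLOCC_of_posSemidef d e
    -- The complement of the span must be assigned to some outcome. It never fires on the given
    -- states, so outcome `0`, available since `0 < m`, can absorb it.
    (fun i : Fin m => rankOne (ψ i) + if i = ⟨0, hm⟩ then 1 - ∑ i, rankOne (ψ i) else 0)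
    (by
      intro i
      refine (posSemidef_rankOne _).add ?_
      split_ifs
      · exact hR
      · exact Matrix.PosSemidef.zero)
    (by simp [Finset.sum_add_distrib])
  refine ⟨M, hM, hsum, fun i j => ?_⟩
  have hin : ∀ i j, ‖inner ℂ (ψ i) (ψ j)‖ ^ 2 = if i = j then (1 : ℝ) else 0 := by
    intro i j
    rw [orthonormal_iff_ite.mp hψ]
    split_ifs <;> simp
  have hrest : expect (if i = ⟨0, hm⟩ then 1 - ∑ i, rankOne (ψ i) else 0) (ψ j) = 0 := by
    split_ifs
    · rw [expect_one_sub_sum_rankOne, hψ.1 j, Finset.sum_congr rfl fun i _ => hin i j]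
      simp
    · simp [expect]
  rw [hexp, expect_add, expect_rankOne, hrest, hin, add_zero]
  split_ifs <;> simp

end Universality

theorem mainTheorem8 (n : ℕ) (d : Fin (n + 1) → ℕ) (hd : ∀ k, 0 < d k)
    (e : ((k : Fin n) → Fin (d k.castSucc)) ≃ Fin (∏ k : Fin n, d k.castSucc)) :
    UniversalUnambiguous d (bellState d e) ∧ UniversalPerfect d (bellState d e) := by
  have : ∀ k, NeZero (d k) := fun k => ⟨(hd k).ne'⟩
  exact ⟨universalUnambiguous_bellState d e, universalPerfect_bellState d e⟩
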